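/- There is a universal constant $C>0$ such that the following holds. Let $N\ge 0$, let $\mathcal X_1,\dots,\mathcal X_N$, $\Sigma$, $\Lambda$ be finite sets, and let $X=(X_1,\dots,X_N)$ be a random tuple with $X_i\in\mathcal X_i$ which is unbiased (each $X_i$ is uniformly distributed on $\mathcal X_i$) and pairwise independent ($X_i$ and $X_j$ are independent for all $i\neq j$). Alice and Bob play the following information causality game with an arbitrary quantum strategy. They share a unit vector $\psi\in H_A\otimes H_B$, where $H_A,H_B$ are complex Hilbert spaces of arbitrary dimension. Alice receives $X$; on $X=x$ she measures her system with a POVM $(A_x^\alpha)_{\alpha\in\Sigma}$ and sends the outcome $\alpha\in\Sigma$ to Bob. Bob receives an index $b\in\{1,\dots,N\}$; given $b=i$ and the message $\alpha$ he measures his system with a POVM $(B_{i,\alpha}^z)_{z\in\Lambda}$ and outputs the outcome $Z\in\Lambda$. Thus $$\Pr[Z=z\mid X=x,\,b=i]=\sum_{\alpha\in\Sigma}\langle\psi|\,A_x^\alpha\otimes B_{i,\alpha}^z\,|\psi\rangle .$$ Then $$\sum_{i=1}^N I(X_i;Z\mid b=i)\;\le\; C\,|\Sigma|\,|\Lambda|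 ,$$ where $I(X_i;Z\mid b=i)$ is the mutual information (in bits) of $X_i$ and $Z$ when Bob's input is $i$. In particular the bound depends only on $|\Sigma|$ and $|\Lambda|$, and not on $N$ or on the sets $\mathcal X_i$. -/

import Mathlib

open scoped TensorProduct InnerProductSpace

noncomputable section

/-- A (finite-outcome) POVM on a Hilbert space `H`: positive bounded operators, indexed by the
outcomes, which sum to the identity. -/
def IsPOVM {H Ω : Type*} [NormedAddCommGroup H] [InnerProductSpace ℂ H] [Fintype Ω]
    (E : Ω → (H →L[ℂ] H)) : Prop :=
  (∀ ω, (E ω).IsPositive) ∧ ∑ ω, E ω = 1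

/-- The Hilbert space tensor product of `H` and `K`: the completion of the algebraic tensor product
with respect to the inner product `⟪a ⊗ b, c ⊗ d⟫ = ⟪a, c⟫ * ⟪b, d⟫`. -/
abbrev HilbertTensor (H K : Type*) [NormedAddCommGroup H] [InnerProductSpace ℂ H]
    [NormedAddCommGroup K] [InnerProductSpace ℂ K] : Type _ :=
  UniformSpace.Completion (H ⊗[ℂ] K)

/-- The bounded operator `S ⊗ T` on the Hilbert space tensor product. -/
def tensorOp {H K : Type*} [NormedAddCommGroup H] [InnerProductSpace ℂ H]
    [NormedAddCommGroup K] [InnerProductSpace ℂ K] (S : H →L[ℂ] H) (T : K →L[ℂ] K) :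
    HilbertTensor H K →L[ℂ] HilbertTensor H K :=
  (TensorProduct.mapL S T).completion

/-- A quantum strategy for the information causality game in which Alice's input is a tuple
`x = (x₁, …, x_N)` with `x_i ∈ 𝒳 i`, Bob's input is an index in `Fin N`, Alice's message lies in `S`
and Bob's output lies in `L`. Alice holds `HA`, Bob holds `HB`, and they share the unit vector
`ψ`. On input `x` Alice measures her system with the POVM `A x` and sends the outcome to Bob;
on input `i` and message `α`, Bob measures his system with the POVM `B i α` and outputs
the outcome. -/
structure ICStrategy {N : ℕ} (𝒳 : Fin N → Type*) (S L : Type*) [Fintype S] [Fintype L]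
    (HA HB : Type*) [NormedAddCommGroup HA] [InnerProductSpace ℂ HA]
    [NormedAddCommGroup HB] [InnerProductSpace ℂ HB] where
  ψ : HilbertTensor HA HB
  norm_ψ : ‖ψ‖ = 1
  A : (∀ i, 𝒳 i) → S → (HA →L[ℂ] HA)
  isPOVM_A : ∀ x, IsPOVM (A x)
  B : Fin N → S → L → (HB →L[ℂ] HB)
  isPOVM_B : ∀ i α, IsPOVM (B i α)

/-- The probability that Bob outputs `z` when Alice's input is `x` and Bob's input is `i`:
the sum over all messages `α` of the Born probabilities `⟨ψ| A_x^α ⊗ B_{i,α}^z |ψ⟩`. -/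
def ICStrategy.outputProb {N : ℕ} {𝒳 : Fin N → Type*} {S L : Type*} [Fintype S] [Fintype L]
    {HA HB : Type*} [NormedAddCommGroup HA] [InnerProductSpace ℂ HA]
    [NormedAddCommGroup HB] [InnerProductSpace ℂ HB]
    (P : ICStrategy 𝒳 S L HA HB) (x : ∀ i, 𝒳 i) (i : Fin N) (z : L) : ℝ :=
  ∑ α, (⟪P.ψ, tensorOp (P.A x α) (P.B i α z) P.ψ⟫_ℂ).re

open Classical in
/-- The joint law of `(X_i, Z)` given that Bob's input is `b = i`, when Alice's input `X` has
law `π`. -/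
def ICStrategy.jointLaw {N : ℕ} {𝒳 : Fin N → Type*} [∀ i, Fintype (𝒳 i)] {S L : Type*}
    [Fintype S] [Fintype L]
    {HA HB : Type*} [NormedAddCommGroup HA] [InnerProductSpace ℂ HA]
    [NormedAddCommGroup HB] [InnerProductSpace ℂ HB]
    (P : ICStrategy 𝒳 S L HA HB) (π : PMF (∀ i, 𝒳 i)) (i : Fin N) (a : 𝒳 i) (z : L) : ℝ :=
  ∑ x : (∀ j, 𝒳 j), if x i = a then (π x).toReal * P.outputProb x i z else 0

/-- The mutual information (in bits) of two random variables with finite alphabets and joint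
probability mass function `J`; a term with `J a z = 0` vanishes. -/
def mutualInfo {V W : Type*} [Fintype V] [Fintype W] (J : V → W → ℝ) : ℝ :=
  ∑ a, ∑ z, J a z * Real.logb 2 (J a z / ((∑ z', J a z') * ∑ a', J a' z))

/-- The quantity `IC(A,B) = ∑_i I(X_i; Z | b = i)`. -/
def ICStrategy.IC {N : ℕ} {𝒳 : Fin N → Type*} [∀ i, Fintype (𝒳 i)] {S L : Type*}
    [Fintype S] [Fintype L]
    {HA HB : Type*} [NormedAddCommGroup HA] [InnerProductSpace ℂ HA]
    [NormedAddCommGroup HB] [InnerProductSpace ℂ HB]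
    (P : ICStrategy 𝒳 S L HA HB) (π : PMF (∀ i, 𝒳 i)) : ℝ :=
  ∑ i, mutualInfo (P.jointLaw π i)

/-- Every coordinate is uniformly distributed on its alphabet. -/
def IsUnbiased {N : ℕ} {𝒳 : Fin N → Type*} [∀ i, Fintype (𝒳 i)] (π : PMF (∀ i, 𝒳 i)) : Prop :=
  ∀ (i : Fin N) (a : 𝒳 i), π.map (fun x => x i) a = (Fintype.card (𝒳 i) : ENNReal)⁻¹

/-- Any two distinct coordinates are independent. -/
def IsPairwiseIndep {N : ℕ} {𝒳 : Fin N → Type*} (π : PMF (∀ i, 𝒳 i)) : Prop :=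
  ∀ i j : Fin N, i ≠ j → ∀ (a : 𝒳 i) (b : 𝒳 j),
    π.map (fun x => (x i, x j)) (a, b) = π.map (fun x => x i) a * π.map (fun x => x j) b

end

/-! Since `log t ≤ t - 1`, mutual information is at most `1 / log 2` times the χ²-divergence from
the product law. For fixed `z`, let `Q i` be the probability of output `z`, `g i a` the excess of
its probability given `X_i = a` over `Q i`, and `V i` the variance of `g i`. The claim becomes `D =
∑ V i / Q i ≤ |S|` for each `z`; summing over `z` gives the factor `|L|`. Pairwise independence
makes the mean-zero functions `g i (x i)` orthogonal. For a fixed message, Bob holds an unnormalised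
state `τ x` dominated by his reduced state `T`. Cauchy–Schwarz for `tr (Y R W R)`, with `R² = 𝔼 τ`,
bounds the squared combined correlation of the `g i` with Bob's effects by their variances weighted
by outcome probabilities, without cross terms (`Matrix.sq_sum_re_trace_le_of_posDef`, transferred to
Hilbert spaces by `sq_sum_inner_tensorOp_le`). With coefficients `1 / Q i`, the correlations and the
bounds each sum over messages to `D`, so `D² ≤ |S| D` (`ICStrategy.sum_chiSq_le`). -/

/-! ### Trace inequalities for positive matrices -/

open scoped ComplexOrder MatrixOrder in
theorem Matrix.PosSemidef.re_trace_mul_nonneg {n : Type*} [Fintype n]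
    {A B : Matrix n n ℂ} (hA : A.PosSemidef) (hB : B.PosSemidef) : 0 ≤ (A * B).trace.re := by
  classical
  obtain ⟨C, rfl⟩ := CStarAlgebra.nonneg_iff_eq_star_mul_self.mp hA.nonneg
  have h : (star C * C * B).trace = (C * B * C.conjTranspose).trace := by
    rw [mul_assoc, Matrix.trace_mul_comm, Matrix.star_eq_conjTranspose]
  rw [h]
  exact (Complex.nonneg_iff.mp (hB.mul_mul_conjTranspose_same C).trace_nonneg).1

open scoped ComplexOrder MatrixOrder in
theorem Matrix.PosDef.exists_posDef_mul_self {n : Type*} [Fintype n] [DecidableEq n]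
    {A : Matrix n n ℂ} (hA : A.PosDef) : ∃ R : Matrix n n ℂ, R.PosDef ∧ R * R = A := by
  have h : CFC.sqrt A * CFC.sqrt A = A := CFC.sqrt_mul_sqrt_self A hA.posSemidef.nonneg
  refine ⟨CFC.sqrt A, ?_, h⟩
  rw [(Matrix.nonneg_iff_posSemidef.mp (CFC.sqrt_nonneg A)).posDef_iff_isUnit]
  exact isUnit_of_mul_isUnit_left (h ▸ hA.isUnit)

open scoped ComplexOrder in
/-- If `R` is positive semidefinite then `(Y, W) ↦ tr (Y R W R)` is a positive semidefinite form on
Hermitian matrices; this is its Cauchy–Schwarz inequality, averaged with nonnegative weights. -/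
theorem Matrix.sq_sum_re_trace_le {n X : Type*} [Fintype n] [Fintype X]
    {R : Matrix n n ℂ} (hR : R.PosSemidef) {w : X → ℝ} (hw : ∀ x, 0 ≤ w x)
    {Y W : X → Matrix n n ℂ} (hY : ∀ x, (Y x).IsHermitian) (hW : ∀ x, (W x).IsHermitian) :
    (∑ x, w x * (Y x * R * W x * R).trace.re) ^ 2 ≤
      (∑ x, w x * (W x * R * W x * R).trace.re) * ∑ x, w x * (Y x * R * Y x * R).trace.re := by
  -- This quadratic is the averaged form at `Y - t W`; a nonpositive discriminant is Cauchy–Schwarz.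
  have key : ∀ t : ℝ, 0 ≤ (∑ x, w x * (W x * R * W x * R).trace.re) * (t * t)
      + (-2 * ∑ x, w x * (Y x * R * W x * R).trace.re) * t
      + ∑ x, w x * (Y x * R * Y x * R).trace.re := by
    intro t
    have h0 : 0 ≤ ∑ x, w x * ((Y x - t • W x) * R * (Y x - t • W x) * R).trace.re := by
      refine Finset.sum_nonneg fun x _ => mul_nonneg (hw x) ?_
      have hZ : (Y x - t • W x).IsHermitian :=
        (hY x).sub ((hW x).smul (IsSelfAdjoint.all t))
      have := hR.mul_mul_conjTranspose_same (Y x - t • W x)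
      rw [hZ.eq] at this
      exact this.re_trace_mul_nonneg hR
    convert h0 using 1
    have hsym : ∀ x, (W x * R * Y x * R).trace = (Y x * R * W x * R).trace := by
      intro x
      rw [mul_assoc (W x * R), Matrix.trace_mul_comm, ← mul_assoc]
    rw [Finset.sum_mul, Finset.mul_sum, Finset.sum_mul, ← Finset.sum_add_distrib,
      ← Finset.sum_add_distrib]
    refine Finset.sum_congr rfl fun x _ => ?_
    simp only [sub_mul, mul_sub, smul_mul_assoc, mul_smul_comm, Matrix.trace_sub,
      Matrix.trace_smul, hsym, Complex.sub_re, Complex.smul_re, smul_eq_mul]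
    ring
  have := discrim_le_zero key
  simp only [discrim] at this
  nlinarith

-- Cauchy–Schwarz pairs `Y x = ∑ c i u i x B i` with `W x = R⁻¹ τ x R⁻¹`, where `R² = ∑ w x τ x`.
-- The `W` factor is at most `tr T` because the `W x` average to the identity and `τ x ≤ T`. In the
-- `Y` factor orthogonality of the `u i` leaves only diagonal terms, and `B i ≤ 1` makes each linear
-- in `B i`.
open scoped ComplexOrder in
theorem Matrix.sq_sum_re_trace_le_of_posDef {ι X n : Type*} [Fintype ι] [Fintype X] [Fintype n]
    [DecidableEq n] {w : X → ℝ} (hw : ∀ x, 0 ≤ w x) {τ : X → Matrix n n ℂ} {T : Matrix n n ℂ}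
    (hτ : ∀ x, (τ x).PosSemidef) (hT : ∀ x, (T - τ x).PosSemidef) (hdef : (∑ x, w x • τ x).PosDef)
    {u : ι → X → ℝ} (hu : ∀ i j, i ≠ j → ∑ x, w x * (u i x * u j x) = 0)
    {B : ι → Matrix n n ℂ} (hB : ∀ i, (B i).PosSemidef) (hB1 : ∀ i, (1 - B i).PosSemidef)
    (c : ι → ℝ) :
    (∑ i, c i * ∑ x, w x * (u i x * (τ x * B i).trace.re)) ^ 2 ≤
      T.trace.re * ∑ i, c i ^ 2 * (∑ x, w x * u i x ^ 2) *
        ((∑ x, w x • τ x) * B i).trace.re := by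
  obtain ⟨R, hR, hRR⟩ := hdef.exists_posDef_mul_self
  have hRu : IsUnit R.det := (Matrix.isUnit_iff_isUnit_det _).mp hR.isUnit
  set W : X → Matrix n n ℂ := fun x => R⁻¹ * τ x * R⁻¹ with hWdef
  set Y : X → Matrix n n ℂ := fun x => ∑ i, (c i * u i x) • B i with hYdef
  have hRi : R⁻¹.conjTranspose = R⁻¹ := hR.inv.isHermitian.eq
  have hWpos : ∀ x, (W x).PosSemidef := fun x => by
    have := (hτ x).mul_mul_conjTranspose_same R⁻¹
    rwa [hRi] at this
  have hRWR : ∀ x, R * W x * R = τ x := fun x => by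
    simp only [hWdef, mul_assoc, Matrix.nonsing_inv_mul _ hRu, mul_one]
    rw [← mul_assoc, Matrix.mul_nonsing_inv _ hRu, one_mul]
  have hWsum : ∑ x, w x • W x = 1 := by
    have : ∑ x, w x • W x = R⁻¹ * (∑ x, w x • τ x) * R⁻¹ := by
      simp only [hWdef, Finset.mul_sum, Finset.sum_mul, mul_smul_comm, smul_mul_assoc]
    rw [this, ← hRR, ← mul_assoc, Matrix.nonsing_inv_mul _ hRu, one_mul,
      Matrix.mul_nonsing_inv _ hRu]
  have hY : ∀ x, (Y x).IsHermitian := fun x => by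
    simp only [hYdef, Matrix.IsHermitian, Matrix.conjTranspose_sum, Matrix.conjTranspose_smul,
      (hB _).isHermitian.eq, star_trivial]
  have hCS := Matrix.sq_sum_re_trace_le hR.posSemidef hw hY fun x => (hWpos x).isHermitian
  have hL : ∑ x, w x * (Y x * R * W x * R).trace.re =
      ∑ i, c i * ∑ x, w x * (u i x * (τ x * B i).trace.re) := by
    simp only [Finset.mul_sum]
    rw [Finset.sum_comm]
    refine Finset.sum_congr rfl fun x _ => ?_
    rw [mul_assoc (Y x), mul_assoc (Y x), hRWR]
    simp only [hYdef, Finset.sum_mul, Matrix.trace_sum, smul_mul_assoc, Matrix.trace_smul,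
      Complex.re_sum, Complex.smul_re, smul_eq_mul, Finset.mul_sum]
    refine Finset.sum_congr rfl fun i _ => ?_
    rw [Matrix.trace_mul_comm]
    ring
  have hWW : ∑ x, w x * (W x * R * W x * R).trace.re ≤ T.trace.re := by
    calc _ ≤ ∑ x, w x * (W x * T).trace.re := by
          refine Finset.sum_le_sum fun x _ => mul_le_mul_of_nonneg_left ?_ (hw x)
          have := (hWpos x).re_trace_mul_nonneg (hT x)
          rw [mul_sub, Matrix.trace_sub, Complex.sub_re] at this
          rw [mul_assoc (W x), mul_assoc (W x), hRWR]
          linarith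
      _ = ((∑ x, w x • W x) * T).trace.re := by
          simp only [Finset.sum_mul, Matrix.trace_sum, smul_mul_assoc, Matrix.trace_smul,
            Complex.re_sum, Complex.smul_re, smul_eq_mul]
      _ = T.trace.re := by rw [hWsum, one_mul]
  have hYY : ∑ x, w x * (Y x * R * Y x * R).trace.re ≤
      ∑ i, c i ^ 2 * (∑ x, w x * u i x ^ 2) * ((∑ x, w x • τ x) * B i).trace.re := by
    have h1 : ∑ x, w x * (Y x * R * Y x * R).trace.re =
        ∑ i, ∑ j, (c i * c j * ∑ x, w x * (u i x * u j x)) * (B i * R * B j * R).trace.re := by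
      simp only [Finset.mul_sum, Finset.sum_mul]
      rw [Finset.sum_congr rfl fun i _ => Finset.sum_comm, Finset.sum_comm]
      refine Finset.sum_congr rfl fun x _ => ?_
      simp only [hYdef, Finset.sum_mul, Finset.mul_sum, Matrix.trace_sum, smul_mul_assoc,
        mul_smul_comm, Matrix.trace_smul, Complex.re_sum, Complex.smul_re, smul_eq_mul]
      rw [Finset.sum_comm]
      refine Finset.sum_congr rfl fun i _ => Finset.sum_congr rfl fun j _ => ?_
      ring
    rw [h1]
    refine Finset.sum_le_sum fun i _ => ?_
    rw [Finset.sum_eq_single i (fun j _ hj => by rw [hu i j hj.symm]; ring) (by simp)]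
    have h2 : ∑ x, w x * (u i x * u i x) = ∑ x, w x * u i x ^ 2 := by simp only [sq]
    rw [h2, ← sq]
    refine mul_le_mul_of_nonneg_left ?_ (mul_nonneg (sq_nonneg _)
      (Finset.sum_nonneg fun x _ => mul_nonneg (hw x) (sq_nonneg _)))
    have h3 : (R * B i * R).PosSemidef := by
      have := (hB i).mul_mul_conjTranspose_same R
      rwa [hR.isHermitian.eq] at this
    have h4 := h3.re_trace_mul_nonneg (hB1 i)
    rw [mul_sub, mul_one, Matrix.trace_sub, Complex.sub_re] at h4
    have h5 : (B i * R * B i * R).trace = (R * B i * R * B i).trace := by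
      rw [Matrix.trace_mul_comm]
      simp only [mul_assoc]
    have h6 : (R * B i * R).trace = (R * R * B i).trace := by
      rw [Matrix.trace_mul_comm, ← mul_assoc]
    rw [h5, ← hRR, ← h6]
    linarith
  -- `T` is not assumed positive; its trace dominates the nonnegative `W` factor.
  have hTr : 0 ≤ T.trace.re := le_trans (Finset.sum_nonneg fun x _ => mul_nonneg (hw x) (by
    have := hR.posSemidef.mul_mul_conjTranspose_same (W x)
    rw [(hWpos x).isHermitian.eq] at this
    exact this.re_trace_mul_nonneg hR.posSemidef)) hWW
  rw [← hL]
  refine hCS.trans (mul_le_mul hWW hYY (Finset.sum_nonneg fun x _ => mul_nonneg (hw x) ?_) hTr)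
  have := hR.posSemidef.mul_mul_conjTranspose_same (Y x)
  rw [(hY x).eq] at this
  exact this.re_trace_mul_nonneg hR.posSemidef

-- Definiteness of the average is removed by adding `ε • 1` to every `τ x` and to `T`, then letting
-- `ε → 0`. The left side does not change, because each `u i` has mean zero.
open scoped ComplexOrder in
theorem Matrix.sq_sum_re_trace_mul_le {ι X n : Type*} [Fintype ι] [Fintype X] [Fintype n]
    [DecidableEq n] {w : X → ℝ} (hw : ∀ x, 0 ≤ w x) (hw1 : ∑ x, w x = 1)
    {τ : X → Matrix n n ℂ} {T : Matrix n n ℂ}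
    (hτ : ∀ x, (τ x).PosSemidef) (hT : ∀ x, (T - τ x).PosSemidef)
    {u : ι → X → ℝ} (hu : ∀ i j, i ≠ j → ∑ x, w x * (u i x * u j x) = 0)
    (hu0 : ∀ i, ∑ x, w x * u i x = 0)
    {B : ι → Matrix n n ℂ} (hB : ∀ i, (B i).PosSemidef) (hB1 : ∀ i, (1 - B i).PosSemidef)
    (c : ι → ℝ) :
    (∑ i, c i * ∑ x, w x * (u i x * (τ x * B i).trace.re)) ^ 2 ≤
      T.trace.re * ∑ i, c i ^ 2 * (∑ x, w x * u i x ^ 2) *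
        ∑ x, w x * (τ x * B i).trace.re := by
  have key : ∀ ε : ℝ, 0 < ε → (∑ i, c i * ∑ x, w x * (u i x * (τ x * B i).trace.re)) ^ 2 ≤
      (T.trace.re + ε * (1 : Matrix n n ℂ).trace.re) *
        ∑ i, c i ^ 2 * (∑ x, w x * u i x ^ 2) *
          ((∑ x, w x * (τ x * B i).trace.re) + ε * (B i).trace.re) := by
    intro ε hε
    have hpos : ((ε • 1 : Matrix n n ℂ)).PosDef := Matrix.PosDef.one.smul hε
    have hsum : ∑ x, w x • (τ x + ε • (1 : Matrix n n ℂ)) = ∑ x, w x • τ x + ε • 1 := by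
      simp only [smul_add, Finset.sum_add_distrib, ← Finset.sum_smul, hw1, one_smul]
    have h := Matrix.sq_sum_re_trace_le_of_posDef hw (τ := fun x => τ x + ε • 1) (T := T + ε • 1)
      (fun x => (hτ x).add hpos.posSemidef) (fun x => by simpa using hT x)
      (hsum ▸ hpos.posSemidef_add (Matrix.posSemidef_sum _ fun x _ => (hτ x).smul (hw x)))
      hu hB hB1 c
    convert h using 2
    · refine Finset.sum_congr rfl fun i _ => ?_
      congr 1
      simp only [add_mul, smul_mul_assoc, one_mul, Matrix.trace_add, Matrix.trace_smul,
        Complex.add_re, Complex.smul_re, smul_eq_mul, mul_add, Finset.sum_add_distrib]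
      have : ∑ x, w x * (u i x * (ε * (B i).trace.re)) = 0 := by
        rw [← zero_mul (ε * (B i).trace.re), ← hu0 i, Finset.sum_mul]
        exact Finset.sum_congr rfl fun x _ => by ring
      rw [this, add_zero]
    · simp
    · refine Finset.sum_congr rfl fun i _ => ?_
      congr 1
      rw [hsum]
      simp only [add_mul, smul_mul_assoc, one_mul, Matrix.trace_add, Matrix.trace_smul,
        Complex.add_re, Complex.smul_re, smul_eq_mul, Finset.sum_mul, Matrix.trace_sum,
        Complex.re_sum]
  have hlim : Filter.Tendsto (fun ε : ℝ => (T.trace.re + ε * (1 : Matrix n n ℂ).trace.re) *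
        ∑ i, c i ^ 2 * (∑ x, w x * u i x ^ 2) *
          ((∑ x, w x * (τ x * B i).trace.re) + ε * (B i).trace.re)) (nhdsWithin 0 (Set.Ioi 0))
      (nhds (T.trace.re * ∑ i, c i ^ 2 * (∑ x, w x * u i x ^ 2) *
        ∑ x, w x * (τ x * B i).trace.re)) := by
    refine Filter.Tendsto.mono_left ?_ nhdsWithin_le_nhds
    refine (Continuous.tendsto' (by fun_prop) _ _ ?_)
    simp
  exact ge_of_tendsto hlim (Filter.eventually_of_mem self_mem_nhdsWithin fun ε hε => key ε hε)

/-! ### From Hilbert space tensors to matrices -/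

/-- The matrix of the sesquilinear form of an operator `S` on a finite family of vectors. -/
noncomputable def compressionMatrix {H n : Type*} [NormedAddCommGroup H] [InnerProductSpace ℂ H]
    (a : n → H) (S : H →L[ℂ] H) : Matrix n n ℂ :=
  Matrix.of fun k l => ⟪a k, S (a l)⟫_ℂ

theorem compressionMatrix_sub {H n : Type*} [NormedAddCommGroup H] [InnerProductSpace ℂ H]
    (a : n → H) (S T : H →L[ℂ] H) :
    compressionMatrix a (S - T) = compressionMatrix a S - compressionMatrix a T := by
  ext k l
  simp [compressionMatrix]

theorem compressionMatrix_one {H n : Type*} [NormedAddCommGroup H] [InnerProductSpace ℂ H]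
    [DecidableEq n] {a : n → H} (ha : Orthonormal ℂ a) : compressionMatrix a 1 = 1 := by
  ext k l
  simp [compressionMatrix, orthonormal_iff_ite.mp ha, Matrix.one_apply]

open scoped ComplexOrder in
theorem compressionMatrix_posSemidef {H n : Type*} [NormedAddCommGroup H] [InnerProductSpace ℂ H]
    [Fintype n] (a : n → H) {S : H →L[ℂ] H} (hS : S.IsPositive) :
    (compressionMatrix a S).PosSemidef := by
  refine Matrix.PosSemidef.of_dotProduct_mulVec_nonneg ?_ fun v => ?_
  · ext k l
    simp only [compressionMatrix, Matrix.conjTranspose_apply, Matrix.of_apply]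
    rw [← hS.inner_left_eq_inner_right]
    exact inner_conj_symm _ _
  · have h : star v ⬝ᵥ (compressionMatrix a S).mulVec v =
        ⟪∑ k, v k • a k, S (∑ l, v l • a l)⟫_ℂ := by
      simp only [compressionMatrix, dotProduct, Matrix.mulVec, Matrix.of_apply, map_sum, map_smul,
        sum_inner, inner_sum, inner_smul_left, inner_smul_right, Finset.mul_sum, Pi.star_apply]
      rw [Finset.sum_comm]
      refine Finset.sum_congr rfl fun k _ => Finset.sum_congr rfl fun l _ => ?_
      simp only [RCLike.star_def]
      ring
    rw [h]
    exact hS.inner_nonneg_right _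

/-- Only the second family is orthonormal: this keeps Bob's compressed effects below the identity,
while the first family carries the weights of the state. -/
theorem TensorProduct.exists_orthonormal_sum_tmul {E F : Type*} [AddCommGroup E] [Module ℂ E]
    [NormedAddCommGroup F] [InnerProductSpace ℂ F] (ψ : E ⊗[ℂ] F) :
    ∃ (n : ℕ) (a : Fin n → E) (b : Fin n → F), Orthonormal ℂ b ∧ ψ = ∑ k, a k ⊗ₜ[ℂ] b k := by
  classical
  obtain ⟨s, hs⟩ := TensorProduct.exists_finset ψ
  let U : Submodule ℂ F := Submodule.span ℂ (s.image Prod.snd : Finset F)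
  let e := stdOrthonormalBasis ℂ U
  have hmem : ∀ p ∈ s, p.2 ∈ U := fun p hp =>
    Submodule.subset_span (Finset.mem_coe.mpr (Finset.mem_image_of_mem _ hp))
  refine ⟨_, fun k => ∑ p ∈ s, ⟪(e k : F), p.2⟫_ℂ • p.1, fun k => (e k : F),
    e.orthonormal.comp_linearIsometry U.subtypeₗᵢ, ?_⟩
  have hrep : ∀ p ∈ s, p.1 ⊗ₜ[ℂ] p.2 = ∑ k, (⟪(e k : F), p.2⟫_ℂ • p.1) ⊗ₜ[ℂ] (e k : F) := by
    intro p hp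
    have h := congrArg (Subtype.val) (e.sum_repr' ⟨p.2, hmem p hp⟩)
    simp only [Submodule.coe_sum, Submodule.coe_smul, Submodule.coe_inner] at h
    conv_lhs => rw [← h]
    simp only [TensorProduct.tmul_sum, TensorProduct.tmul_smul, TensorProduct.smul_tmul']
  simp only [TensorProduct.sum_tmul]
  rw [hs, Finset.sum_comm]
  exact Finset.sum_congr rfl hrep

theorem inner_mapL_sum_tmul {E F n : Type*} [NormedAddCommGroup E] [InnerProductSpace ℂ E]
    [NormedAddCommGroup F] [InnerProductSpace ℂ F] [Fintype n] (a : n → E) (b : n → F)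
    (S : E →L[ℂ] E) (T : F →L[ℂ] F) :
    ⟪∑ k, a k ⊗ₜ[ℂ] b k, TensorProduct.mapL S T (∑ k, a k ⊗ₜ[ℂ] b k)⟫_ℂ =
      ((compressionMatrix a S).transpose * compressionMatrix b T).trace := by
  simp only [map_sum, TensorProduct.mapL_tmul, sum_inner, inner_sum, TensorProduct.inner_tmul,
    compressionMatrix, Matrix.trace, Matrix.diag_apply, Matrix.mul_apply, Matrix.transpose_apply,
    Matrix.of_apply]

theorem inner_tensorOp_coe {H K : Type*} [NormedAddCommGroup H] [InnerProductSpace ℂ H]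
    [NormedAddCommGroup K] [InnerProductSpace ℂ K] (S : H →L[ℂ] H) (T : K →L[ℂ] K)
    (ψ : H ⊗[ℂ] K) :
    ⟪(ψ : HilbertTensor H K), tensorOp S T ψ⟫_ℂ = ⟪ψ, TensorProduct.mapL S T ψ⟫_ℂ := by
  have h : tensorOp S T (ψ : HilbertTensor H K) = (TensorProduct.mapL S T ψ : H ⊗[ℂ] K) :=
    UniformSpace.Completion.map_coe (TensorProduct.mapL S T).uniformContinuous ψ
  rw [h, UniformSpace.Completion.inner_coe]

theorem continuous_inner_tensorOp {H K : Type*} [NormedAddCommGroup H] [InnerProductSpace ℂ H]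
    [NormedAddCommGroup K] [InnerProductSpace ℂ K] (S : H →L[ℂ] H) (T : K →L[ℂ] K) :
    Continuous fun ψ : HilbertTensor H K => (⟪ψ, tensorOp S T ψ⟫_ℂ).re :=
  Complex.continuous_re.comp (continuous_id.inner (tensorOp S T).continuous)

open scoped ComplexOrder in
theorem re_inner_tensorOp_nonneg {H K : Type*} [NormedAddCommGroup H] [InnerProductSpace ℂ H]
    [NormedAddCommGroup K] [InnerProductSpace ℂ K] {S : H →L[ℂ] H} {T : K →L[ℂ] K}
    (hS : S.IsPositive) (hT : T.IsPositive) (ψ : HilbertTensor H K) :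
    0 ≤ (⟪ψ, tensorOp S T ψ⟫_ℂ).re := by
  induction ψ using UniformSpace.Completion.induction_on with
  | hp => exact isClosed_le continuous_const (continuous_inner_tensorOp S T)
  | ih ψ =>
    rw [inner_tensorOp_coe]
    obtain ⟨n, a, b, -, rfl⟩ := TensorProduct.exists_orthonormal_sum_tmul ψ
    rw [inner_mapL_sum_tmul]
    exact (compressionMatrix_posSemidef a hS).transpose.re_trace_mul_nonneg
      (compressionMatrix_posSemidef b hT)

-- Both sides are continuous in `ψ`, so algebraic tensors suffice. For these the matrix inequality
-- applies to transposed Gram matrices on Alice's side, with `T` that of the identity, whose trace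
-- is `‖ψ‖ ^ 2`.
open scoped ComplexOrder in
theorem sq_sum_inner_tensorOp_le {ι X H K : Type*} [Fintype ι] [Fintype X]
    [NormedAddCommGroup H] [InnerProductSpace ℂ H] [NormedAddCommGroup K] [InnerProductSpace ℂ K]
    {w : X → ℝ} (hw : ∀ x, 0 ≤ w x) (hw1 : ∑ x, w x = 1)
    {S : X → H →L[ℂ] H} (hS : ∀ x, (S x).IsPositive) (hS1 : ∀ x, (1 - S x).IsPositive)
    {u : ι → X → ℝ} (hu : ∀ i j, i ≠ j → ∑ x, w x * (u i x * u j x) = 0)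
    (hu0 : ∀ i, ∑ x, w x * u i x = 0)
    {T : ι → K →L[ℂ] K} (hT : ∀ i, (T i).IsPositive) (hT1 : ∀ i, (1 - T i).IsPositive)
    (c : ι → ℝ) (ψ : HilbertTensor H K) :
    (∑ i, c i * ∑ x, w x * (u i x * (⟪ψ, tensorOp (S x) (T i) ψ⟫_ℂ).re)) ^ 2 ≤
      ‖ψ‖ ^ 2 * ∑ i, c i ^ 2 * (∑ x, w x * u i x ^ 2) *
        ∑ x, w x * (⟪ψ, tensorOp (S x) (T i) ψ⟫_ℂ).re := by
  induction ψ using UniformSpace.Completion.induction_on with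
  | hp =>
    have h := fun x i => continuous_inner_tensorOp (S x) (T i)
    exact isClosed_le (by fun_prop) (by fun_prop)
  | ih ψ =>
    simp only [inner_tensorOp_coe, UniformSpace.Completion.norm_coe]
    obtain ⟨n, a, b, hb, hψ⟩ := TensorProduct.exists_orthonormal_sum_tmul ψ
    have hnorm : ‖ψ‖ ^ 2 = ((compressionMatrix a 1).transpose).trace.re := by
      have h := inner_mapL_sum_tmul a b 1 1
      rw [← hψ, compressionMatrix_one hb, mul_one] at h
      rw [← h, ← inner_self_eq_norm_sq (𝕜 := ℂ)]
      have h1 : TensorProduct.mapL (1 : H →L[ℂ] H) (1 : K →L[ℂ] K) ψ = ψ :=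
        congrArg (· ψ) TensorProduct.mapL_id_id
      rw [h1]
      rfl
    rw [hnorm]
    subst hψ
    simp only [inner_mapL_sum_tmul]
    refine Matrix.sq_sum_re_trace_mul_le hw hw1
      (fun x => (compressionMatrix_posSemidef a (hS x)).transpose) (fun x => ?_) hu hu0
      (fun i => compressionMatrix_posSemidef b (hT i)) (fun i => ?_) c
    · rw [← Matrix.transpose_sub, ← compressionMatrix_sub]
      exact (compressionMatrix_posSemidef a (hS1 x)).transpose
    · rw [← compressionMatrix_one hb, ← compressionMatrix_sub]
      exact compressionMatrix_posSemidef b (hT1 i)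

/-! ### POVM sums and output probabilities -/

theorem IsPOVM.one_sub_isPositive {H Ω : Type*} [NormedAddCommGroup H] [InnerProductSpace ℂ H]
    [Fintype Ω] {E : Ω → (H →L[ℂ] H)} (hE : IsPOVM E) (ω : Ω) : (1 - E ω).IsPositive := by
  classical
  rw [← hE.2, ← Finset.sum_erase_eq_sub (Finset.mem_univ ω)]
  exact ContinuousLinearMap.isPositive_sum _ fun i _ => hE.1 i

theorem sum_re_inner_tensorOp_right {H K Ω : Type*} [NormedAddCommGroup H]
    [InnerProductSpace ℂ H] [NormedAddCommGroup K] [InnerProductSpace ℂ K] [Fintype Ω]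
    (S : H →L[ℂ] H) (T : Ω → K →L[ℂ] K) (ψ : HilbertTensor H K) :
    ∑ ω, (⟪ψ, tensorOp S (T ω) ψ⟫_ℂ).re = (⟪ψ, tensorOp S (∑ ω, T ω) ψ⟫_ℂ).re := by
  induction ψ using UniformSpace.Completion.induction_on with
  | hp =>
    have h := fun T => continuous_inner_tensorOp (H := H) (K := K) S T
    exact isClosed_eq (by fun_prop) (by fun_prop)
  | ih ψ =>
    have h : TensorProduct.mapL S (∑ ω, T ω) = ∑ ω, TensorProduct.mapL S (T ω) := by
        classical
        induction (Finset.univ : Finset Ω) using Finset.induction_on with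
        | empty => simp
        | insert ω s hω ih => simp only [Finset.sum_insert hω, TensorProduct.mapL_add_right, ih]
    simp only [inner_tensorOp_coe, h, sum_apply, inner_sum, Complex.re_sum]

theorem sum_re_inner_tensorOp_left {H K Ω : Type*} [NormedAddCommGroup H]
    [InnerProductSpace ℂ H] [NormedAddCommGroup K] [InnerProductSpace ℂ K] [Fintype Ω]
    (S : Ω → H →L[ℂ] H) (T : K →L[ℂ] K) (ψ : HilbertTensor H K) :
    ∑ ω, (⟪ψ, tensorOp (S ω) T ψ⟫_ℂ).re = (⟪ψ, tensorOp (∑ ω, S ω) T ψ⟫_ℂ).re := by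
  induction ψ using UniformSpace.Completion.induction_on with
  | hp =>
    have h := fun S => continuous_inner_tensorOp (H := H) (K := K) S T
    exact isClosed_eq (by fun_prop) (by fun_prop)
  | ih ψ =>
    have h : TensorProduct.mapL (∑ ω, S ω) T = ∑ ω, TensorProduct.mapL (S ω) T := by
        classical
        induction (Finset.univ : Finset Ω) using Finset.induction_on with
        | empty => simp
        | insert ω s hω ih => simp only [Finset.sum_insert hω, TensorProduct.mapL_add_left, ih]
    simp only [inner_tensorOp_coe, h, sum_apply, inner_sum, Complex.re_sum]

theorem re_inner_tensorOp_one_one {H K : Type*} [NormedAddCommGroup H]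
    [InnerProductSpace ℂ H] [NormedAddCommGroup K] [InnerProductSpace ℂ K]
    (ψ : HilbertTensor H K) :
    (⟪ψ, tensorOp (1 : H →L[ℂ] H) (1 : K →L[ℂ] K) ψ⟫_ℂ).re = ‖ψ‖ ^ 2 := by
  induction ψ using UniformSpace.Completion.induction_on with
  | hp =>
    have h := continuous_inner_tensorOp (1 : H →L[ℂ] H) (1 : K →L[ℂ] K)
    exact isClosed_eq (by fun_prop) (by fun_prop)
  | ih ψ =>
    have h1 : TensorProduct.mapL (1 : H →L[ℂ] H) (1 : K →L[ℂ] K) ψ = ψ :=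
      congrArg (· ψ) TensorProduct.mapL_id_id
    rw [inner_tensorOp_coe, h1, UniformSpace.Completion.norm_coe, ← inner_self_eq_norm_sq (𝕜 := ℂ)]
    rfl

section Strategy

variable {N : ℕ} {𝒳 : Fin N → Type*} {S L : Type*} [Fintype S] [Fintype L]
  {HA HB : Type*} [NormedAddCommGroup HA] [InnerProductSpace ℂ HA]
  [NormedAddCommGroup HB] [InnerProductSpace ℂ HB]

theorem ICStrategy.outputProb_nonneg (P : ICStrategy 𝒳 S L HA HB) (x : ∀ i, 𝒳 i) (i : Fin N)
    (z : L) : 0 ≤ P.outputProb x i z :=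
  Finset.sum_nonneg fun α _ =>
    re_inner_tensorOp_nonneg ((P.isPOVM_A x).1 α) ((P.isPOVM_B i α).1 z) P.ψ

theorem ICStrategy.sum_outputProb (P : ICStrategy 𝒳 S L HA HB) (x : ∀ i, 𝒳 i) (i : Fin N) :
    ∑ z, P.outputProb x i z = 1 := by
  simp only [ICStrategy.outputProb]
  rw [Finset.sum_comm]
  simp only [sum_re_inner_tensorOp_right, (P.isPOVM_B i _).2, sum_re_inner_tensorOp_left,
    (P.isPOVM_A x).2, re_inner_tensorOp_one_one, P.norm_ψ, one_pow]

end Strategy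

/-! ### Expectations under unbiased, pairwise independent laws -/

theorem PMF.sum_toReal_mul_comp {X Y : Type*} [Fintype X] [Fintype Y] (p : PMF X) (f : X → Y)
    (φ : Y → ℝ) : ∑ x, (p x).toReal * φ (f x) = ∑ y, (p.map f y).toReal * φ y := by
  classical
  have h : ∀ y, (p.map f y).toReal = ∑ x, if y = f x then (p x).toReal else 0 := by
    intro y
    rw [PMF.map_apply, tsum_fintype, ENNReal.toReal_sum]
    · refine Finset.sum_congr rfl fun x _ => ?_
      split_ifs <;> simp
    · intro x _
      split_ifs
      · exact p.apply_ne_top x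
      · simp
  simp only [h, Finset.sum_mul, ite_mul, zero_mul]
  rw [Finset.sum_comm]
  simp

theorem PMF.sum_toReal_eq_one {X : Type*} [Fintype X] (p : PMF X) : ∑ x, (p x).toReal = 1 := by
  rw [← ENNReal.toReal_sum fun x _ => p.apply_ne_top x, ← tsum_fintype (L := .unconditional _),
    p.tsum_coe, ENNReal.toReal_one]

section Law

variable {N : ℕ} {𝒳 : Fin N → Type*} [∀ i, Fintype (𝒳 i)] {π : PMF (∀ i, 𝒳 i)}

theorem IsUnbiased.sum_mul_comp (hπ : IsUnbiased π) (i : Fin N) (φ : 𝒳 i → ℝ) :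
    ∑ x, (π x).toReal * φ (x i) = (Fintype.card (𝒳 i) : ℝ)⁻¹ * ∑ a, φ a := by
  rw [π.sum_toReal_mul_comp (fun x => x i) φ, Finset.mul_sum]
  simp [hπ i]

theorem IsPairwiseIndep.sum_mul_comp_mul_comp (hπ : IsPairwiseIndep π) {i j : Fin N}
    (hij : i ≠ j) (φ : 𝒳 i → ℝ) (χ : 𝒳 j → ℝ) :
    ∑ x, (π x).toReal * (φ (x i) * χ (x j)) =
      (∑ x, (π x).toReal * φ (x i)) * ∑ x, (π x).toReal * χ (x j) := by
  rw [π.sum_toReal_mul_comp (fun x => (x i, x j)) (fun p => φ p.1 * χ p.2),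
    π.sum_toReal_mul_comp (fun x => x i) φ, π.sum_toReal_mul_comp (fun x => x j) χ,
    Fintype.sum_prod_type, Finset.sum_mul_sum]
  refine Finset.sum_congr rfl fun a _ => Finset.sum_congr rfl fun b _ => ?_
  rw [hπ i j hij, ENNReal.toReal_mul]
  ring

end Law

/-! ### The χ² bound and its sum over Bob's inputs -/

/-- The contribution of one output value to the mutual information with a uniform input is at most
its contribution to the `χ²`-divergence. -/
theorem sum_mul_logb_le_chiSq {V : Type*} [Fintype V] [Nonempty V] {J : V → ℝ}
    (hJ : ∀ a, 0 ≤ J a) :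
    ∑ a, J a * Real.logb 2 (J a / ((Fintype.card V : ℝ)⁻¹ * ∑ a', J a')) ≤
      (Real.log 2)⁻¹ * ((∑ a, J a)⁻¹ *
        ((Fintype.card V : ℝ)⁻¹ * ∑ a, (Fintype.card V * J a - ∑ a', J a') ^ 2)) := by
  set Q := ∑ a, J a with hQ
  have hn : (0 : ℝ) < Fintype.card V := by exact_mod_cast Fintype.card_pos
  set n : ℝ := (Fintype.card V : ℝ) with hn'
  have hlog : 0 < Real.log 2 := Real.log_pos one_lt_two
  have hQ0 : 0 ≤ Q := Finset.sum_nonneg fun a _ => hJ a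
  rcases hQ0.eq_or_lt with h0 | hpos
  · have : ∀ a, J a = 0 := fun a =>
      (Finset.sum_eq_zero_iff_of_nonneg fun a _ => hJ a).mp h0.symm a (Finset.mem_univ a)
    simp [this, ← h0]
  · have hterm : ∀ a, J a * Real.logb 2 (J a / (n⁻¹ * Q)) ≤
        (Real.log 2)⁻¹ * (n * Q⁻¹ * J a ^ 2 - J a) := by
      intro a
      rcases (hJ a).eq_or_lt with h | h
      · simp [← h]
      · have h1 := Real.log_le_sub_one_of_pos (x := J a / (n⁻¹ * Q)) (by positivity)
        calc J a * Real.logb 2 (J a / (n⁻¹ * Q))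
            = (Real.log 2)⁻¹ * (J a * Real.log (J a / (n⁻¹ * Q))) := by
              rw [Real.logb]; ring
          _ ≤ (Real.log 2)⁻¹ * (J a * (J a / (n⁻¹ * Q) - 1)) := by gcongr
          _ = _ := by field_simp
    refine (Finset.sum_le_sum fun a _ => hterm a).trans (le_of_eq ?_)
    rw [← Finset.mul_sum]
    congr 1
    rw [Finset.sum_sub_distrib, ← Finset.mul_sum, ← hQ]
    have : ∑ a, (n * J a - Q) ^ 2 = n ^ 2 * ∑ a, J a ^ 2 - n * Q ^ 2 := by
      have h2 : ∀ a, (n * J a - Q) ^ 2 = n ^ 2 * J a ^ 2 - 2 * n * Q * J a + Q ^ 2 :=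
        fun a => by ring
      simp only [h2, Finset.sum_add_distrib, Finset.sum_sub_distrib, ← Finset.mul_sum, ← hQ,
        Finset.sum_const, Finset.card_univ, nsmul_eq_mul, ← hn']
      ring
    rw [this]
    field_simp

section Bound

variable {N : ℕ} {𝒳 : Fin N → Type*} [∀ i, Fintype (𝒳 i)] {S L : Type*} [Fintype S] [Fintype L]
  {HA HB : Type*} [NormedAddCommGroup HA] [InnerProductSpace ℂ HA]
  [NormedAddCommGroup HB] [InnerProductSpace ℂ HB]

theorem ICStrategy.jointLaw_nonneg (P : ICStrategy 𝒳 S L HA HB) (π : PMF (∀ i, 𝒳 i)) (i : Fin N)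
    (a : 𝒳 i) (z : L) : 0 ≤ P.jointLaw π i a z := by
  refine Finset.sum_nonneg fun x _ => ?_
  split_ifs
  · exact mul_nonneg ENNReal.toReal_nonneg (P.outputProb_nonneg x i z)
  · exact le_rfl

theorem ICStrategy.sum_mul_jointLaw (P : ICStrategy 𝒳 S L HA HB) (π : PMF (∀ i, 𝒳 i)) (i : Fin N)
    (φ : 𝒳 i → ℝ) (z : L) :
    ∑ a, φ a * P.jointLaw π i a z = ∑ x, (π x).toReal * (φ (x i) * P.outputProb x i z) := by
  simp only [ICStrategy.jointLaw, Finset.mul_sum, mul_ite, mul_zero]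
  rw [Finset.sum_comm]
  refine Finset.sum_congr rfl fun x _ => ?_
  rw [Finset.sum_eq_single (x i) (fun a _ ha => if_neg ha.symm) (by simp), if_pos rfl]
  ring

theorem ICStrategy.sum_jointLaw (P : ICStrategy 𝒳 S L HA HB) {π : PMF (∀ i, 𝒳 i)}
    (hπ : IsUnbiased π) (i : Fin N) (a : 𝒳 i) :
    ∑ z, P.jointLaw π i a z = (Fintype.card (𝒳 i) : ℝ)⁻¹ := by
  classical
  have h := hπ.sum_mul_comp i fun b => if b = a then 1 else 0
  simp only [Finset.sum_ite_eq', Finset.mem_univ, if_true, mul_one] at h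
  rw [← h]
  simp only [ICStrategy.jointLaw]
  rw [Finset.sum_comm]
  refine Finset.sum_congr rfl fun x _ => ?_
  split_ifs
  · rw [← Finset.mul_sum, P.sum_outputProb]
  · simp

/-- For a fixed output value, the `χ²`-contributions of all inputs sum to at most the number of
messages. -/
theorem ICStrategy.sum_chiSq_le (P : ICStrategy 𝒳 S L HA HB) {π : PMF (∀ i, 𝒳 i)}
    (hπ : IsUnbiased π) (hπ' : IsPairwiseIndep π) (z : L) :
    ∑ i, (∑ a, P.jointLaw π i a z)⁻¹ * ((Fintype.card (𝒳 i) : ℝ)⁻¹ *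
      ∑ a, (Fintype.card (𝒳 i) * P.jointLaw π i a z - ∑ a', P.jointLaw π i a' z) ^ 2) ≤
        Fintype.card S := by
  obtain ⟨x₀, -⟩ := π.support_nonempty
  have hn : ∀ i, (Fintype.card (𝒳 i) : ℝ) ≠ 0 := fun i =>
    Nat.cast_ne_zero.mpr (Fintype.card_pos_iff.mpr ⟨x₀ i⟩).ne'
  set Q : Fin N → ℝ := fun i => ∑ a, P.jointLaw π i a z with hQ
  set g : ∀ i, 𝒳 i → ℝ := fun i a => Fintype.card (𝒳 i) * P.jointLaw π i a z - Q i with hg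
  set V : Fin N → ℝ := fun i => ∑ x, (π x).toReal * g i (x i) ^ 2 with hV
  set q : S → Fin N → (∀ i, 𝒳 i) → ℝ := fun α i x =>
    (⟪P.ψ, tensorOp (P.A x α) (P.B i α z) P.ψ⟫_ℂ).re with hq
  have hQ0 : ∀ i, 0 ≤ Q i := fun i => Finset.sum_nonneg fun a _ => P.jointLaw_nonneg π i a z
  have hV0 : ∀ i, 0 ≤ V i := fun i =>
    Finset.sum_nonneg fun x _ => mul_nonneg ENNReal.toReal_nonneg (sq_nonneg _)
  have hVeq : ∀ i, V i = (Fintype.card (𝒳 i) : ℝ)⁻¹ * ∑ a, g i a ^ 2 := fun i =>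
    hπ.sum_mul_comp i fun a => g i a ^ 2
  have hgsum : ∀ i, ∑ a, g i a = 0 := fun i => by
    simp only [hg, Finset.sum_sub_distrib, ← Finset.mul_sum, Finset.sum_const, Finset.card_univ,
      nsmul_eq_mul]
    exact sub_self _
  have hgmean : ∀ i, ∑ x, (π x).toReal * g i (x i) = 0 := fun i => by
    rw [hπ.sum_mul_comp i (g i), hgsum, mul_zero]
  -- Given `X_i = a`, the mean output probability is `g i a + Q i`, and the constant `Q i` is
  -- orthogonal to the mean-zero `g i`.
  have hcorr : ∀ i, ∑ x, (π x).toReal * (g i (x i) * ∑ α, q α i x) = V i := fun i => by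
    have h1 := P.sum_mul_jointLaw π i (g i) z
    simp only [ICStrategy.outputProb] at h1
    rw [← h1, hVeq]
    have h2 : ∀ a, g i a ^ 2 =
        Fintype.card (𝒳 i) * (g i a * P.jointLaw π i a z) - Q i * g i a := fun a => by
      simp only [hg]; ring
    simp only [h2, Finset.sum_sub_distrib, ← Finset.mul_sum, hgsum, mul_zero, sub_zero]
    rw [inv_mul_cancel_left₀ (hn i)]
  have hQeq : ∀ i, ∑ x, (π x).toReal * ∑ α, q α i x = Q i := fun i => by
    have h1 := P.sum_mul_jointLaw π i (fun _ => 1) z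
    simp only [ICStrategy.outputProb, one_mul] at h1
    exact h1.symm
  have hα : ∀ α, (∑ i, (Q i)⁻¹ * ∑ x, (π x).toReal * (g i (x i) * q α i x)) ^ 2 ≤
      ∑ i, (Q i)⁻¹ ^ 2 * V i * ∑ x, (π x).toReal * q α i x := fun α => by
    have h := sq_sum_inner_tensorOp_le (fun x => ENNReal.toReal_nonneg (a := π x))
      π.sum_toReal_eq_one (fun x => (P.isPOVM_A x).1 α)
      (fun x => (P.isPOVM_A x).one_sub_isPositive α) (u := fun i x => g i (x i))
      (fun i j hij => by rw [hπ'.sum_mul_comp_mul_comp hij, hgmean, zero_mul]) hgmean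
      (fun i => (P.isPOVM_B i α).1 z) (fun i => (P.isPOVM_B i α).one_sub_isPositive z)
      (fun i => (Q i)⁻¹) P.ψ
    rwa [P.norm_ψ, one_pow, one_mul] at h
  set D := ∑ i, (Q i)⁻¹ * V i with hD
  have hD0 : 0 ≤ D := Finset.sum_nonneg fun i _ => mul_nonneg (inv_nonneg.mpr (hQ0 i)) (hV0 i)
  have hsum : ∑ α, ∑ i, (Q i)⁻¹ * ∑ x, (π x).toReal * (g i (x i) * q α i x) = D := by
    rw [Finset.sum_comm]
    refine Finset.sum_congr rfl fun i _ => ?_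
    rw [← Finset.mul_sum, ← hcorr, Finset.sum_comm]
    simp only [Finset.mul_sum]
  have hsum' : ∑ α, ∑ i, (Q i)⁻¹ ^ 2 * V i * ∑ x, (π x).toReal * q α i x = D := by
    rw [Finset.sum_comm]
    refine Finset.sum_congr rfl fun i _ => ?_
    have h1 : ∑ α, ∑ x, (π x).toReal * q α i x = Q i := by
      rw [← hQeq, Finset.sum_comm]
      simp only [Finset.mul_sum]
    rw [← Finset.mul_sum, h1]
    -- If `Q i = 0`, both sides vanish by the convention `0⁻¹ = 0`.
    by_cases h0 : Q i = 0
    · simp [h0]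
    · field_simp
  have hDD : D ^ 2 ≤ Fintype.card S * D := by
    calc D ^ 2 = (∑ α, ∑ i, (Q i)⁻¹ * ∑ x, (π x).toReal * (g i (x i) * q α i x)) ^ 2 := by
          rw [hsum]
      _ ≤ Fintype.card S *
          ∑ α, (∑ i, (Q i)⁻¹ * ∑ x, (π x).toReal * (g i (x i) * q α i x)) ^ 2 := by
          -- Cauchy–Schwarz over the messages is the source of the factor `|S|`.
          simpa using sq_sum_le_card_mul_sum_sq (s := (Finset.univ : Finset S))
      _ ≤ Fintype.card S * D := by
          rw [← hsum']
          exact mul_le_mul_of_nonneg_left (Finset.sum_le_sum fun α _ => hα α) (Nat.cast_nonneg _)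
  have hfin : D ≤ Fintype.card S := by
    rcases hD0.eq_or_lt with h | h
    · rw [← h]; exact Nat.cast_nonneg _
    · exact le_of_mul_le_mul_right (by rwa [sq] at hDD) h
  simpa only [hD, hVeq] using hfin

theorem ICStrategy.IC_le (P : ICStrategy 𝒳 S L HA HB) {π : PMF (∀ i, 𝒳 i)}
    (hπ : IsUnbiased π) (hπ' : IsPairwiseIndep π) :
    P.IC π ≤ (Real.log 2)⁻¹ * Fintype.card S * Fintype.card L := by
  obtain ⟨x₀, -⟩ := π.support_nonempty
  have hlog : 0 ≤ (Real.log 2)⁻¹ := inv_nonneg.mpr (Real.log_pos one_lt_two).le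
  calc P.IC π = ∑ z, ∑ i, ∑ a, P.jointLaw π i a z * Real.logb 2 (P.jointLaw π i a z /
        ((Fintype.card (𝒳 i) : ℝ)⁻¹ * ∑ a', P.jointLaw π i a' z)) := by
        simp only [ICStrategy.IC, mutualInfo, P.sum_jointLaw hπ]
        rw [Finset.sum_comm]
        exact Finset.sum_congr rfl fun i _ => Finset.sum_comm
    _ ≤ ∑ z : L, (Real.log 2)⁻¹ * Fintype.card S := by
        refine Finset.sum_le_sum fun z _ => ?_
        refine le_trans ?_ (mul_le_mul_of_nonneg_left (P.sum_chiSq_le hπ hπ' z) hlog)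
        rw [Finset.mul_sum]
        refine Finset.sum_le_sum fun i _ => ?_
        have : Nonempty (𝒳 i) := ⟨x₀ i⟩
        exact sum_mul_logb_le_chiSq fun a => P.jointLaw_nonneg π i a z
    _ = _ := by
        rw [Finset.sum_const, Finset.card_univ, nsmul_eq_mul]
        ring

end Bound

theorem theorem3 :
    ∃ C : ℝ, 0 < C ∧
      ∀ (N : ℕ) (𝒳 : Fin N → Type*) [∀ i, Fintype (𝒳 i)]
        (S L : Type*) [Fintype S] [Fintype L]
        (HA HB : Type*) [NormedAddCommGroup HA] [InnerProductSpace ℂ HA] [CompleteSpace HA]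
        [NormedAddCommGroup HB] [InnerProductSpace ℂ HB] [CompleteSpace HB]
        (π : PMF (∀ i, 𝒳 i)), IsUnbiased π → IsPairwiseIndep π →
        ∀ P : ICStrategy 𝒳 S L HA HB,
          P.IC π ≤ C * Fintype.card S * Fintype.card L := by
  exact ⟨(Real.log 2)⁻¹, inv_pos.mpr (Real.log_pos one_lt_two),
    fun _ _ _ _ _ _ _ _ _ _ _ _ _ _ _ _ hπ hπ' P => P.IC_le hπ hπ'⟩
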